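/- Let $P$ be a finite set of $n$ points in the Euclidean plane, and let $K(P)$ be the complete geometric graph on $P$, in which the edge joining two points is drawn as the straight-line segment between them. $P$ is in general position if no three of its points are collinear, and in convex position if no point of $P$ lies in the convex hull of the others. Two edges cross if they have a point in common that is interior to both. A plane perfect matching of $P$ is a perfect matching of $K(P)$ whose edges are pairwise disjoint segments. Two edge-disjoint plane perfect matchings are non-crossing if no edge of one crosses an edge of the other. We say that $m$ pairwise non-crossing plane perfect matchings can be packed into $K(P)$ if there are $m$ plane perfect matchings $M_1,\dots,M_m$ of $P$ that are pairwise edge-disjoint and pairwise non-crossing. Theorem. For every set $P$ of $n\ge 4$ points in general position in the plane, with $n$ even, two pairwise non-crossing plane perfect matchings can be packed into $K(P)$, and at most five can. Both bounds are tight: (a) If $P$ is a set of $n\ge 4$ points in convex position, with $n$ even, then the maximum number of pairwise non-crossing plane perfect matchings that can be packed into $K(P)$ is exactly two; such sets $P$, which are in general position, exist for every even $n\ge 4$. (b) There is a set $P$ of $12$ points in general position for which the maximum number of pairwise non-crossing plane perfect matchings that can be packed into $K(P)$ is exactly five; moreover, there are arbitrarily large finite point sets of even size in general position with this property. -/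

import Mathlib

namespace PlaneMatching

/-- The Euclidean plane. -/
abbrev Plane : Type := EuclideanSpace ℝ (Fin 2)

/-- General position: no three distinct points of `P` lie on a line. -/
def GeneralPosition (P : Finset Plane) : Prop :=
  ∀ a ∈ P, ∀ b ∈ P, ∀ c ∈ P, a ≠ b → a ≠ c → b ≠ c → ¬ Collinear ℝ {a, b, c}

/-- Convex position: no point of `P` lies in the convex hull of the other points of `P`. -/
def ConvexPosition (P : Finset Plane) : Prop :=
  ConvexIndependent ℝ (fun p : P => (p : Plane))

/-- Geometric graphs on the vertex set `P`: the subgraphs of the complete graph `K(P)`, where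
the edge `ab` is drawn as the straight-line segment from `a` to `b`. -/
abbrev GeometricGraph (P : Finset Plane) : Type :=
  (⊤ : SimpleGraph P).Subgraph

/-- The edges `ab` and `cd` cross: they have a point in common that is interior to both. -/
def Cross (a b c d : Plane) : Prop :=
  (openSegment ℝ a b ∩ openSegment ℝ c d).Nonempty

/-- A plane perfect matching: a perfect matching of `K(P)` whose edges are pairwise disjoint as
closed segments (in particular, no two of them cross). -/
def IsPlanePerfectMatching {P : Finset Plane} (M : GeometricGraph P) : Prop :=
  M.IsPerfectMatching ∧
    ∀ a b c d : P, M.Adj a b → M.Adj c d → s(a, b) ≠ s(c, d) →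
      Disjoint (segment ℝ (a : Plane) b) (segment ℝ (c : Plane) d)

/-- Two geometric graphs are edge-disjoint if they share no edge. -/
def EdgeDisjoint {P : Finset Plane} (M N : GeometricGraph P) : Prop :=
  Disjoint M.edgeSet N.edgeSet

/-- `M` and `N` are non-crossing: no edge of `M` crosses an edge of `N`. -/
def NonCrossing {P : Finset Plane} (M N : GeometricGraph P) : Prop :=
  ∀ a b c d : P, M.Adj a b → N.Adj c d → ¬ Cross a b c d

/-- `m` pairwise non-crossing (and pairwise edge-disjoint) plane perfect matchings can be packed
into `K(P)`. -/
def CanPack (P : Finset Plane) (m : ℕ) : Prop :=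
  ∃ M : Fin m → GeometricGraph P,
    (∀ i, IsPlanePerfectMatching (M i)) ∧
      ∀ i j, i ≠ j → EdgeDisjoint (M i) (M j) ∧ NonCrossing (M i) (M j)

end PlaneMatching

/-! A packing of `m` matchings is an `m`-regular straight-line plane graph whose edges are coloured
by `m` perfect matchings, so it has `m * n / 2` edges.

Upper bound: a plane graph on `n` vertices has fewer than `3 * n` edges (`IsPlaneDrawing.card_lt`),
hence `m < 6`. The edge bound comes not from Euler's formula but from an injective charging. Each
edge is charged either to its left endpoint or to the first vertex met in the wedge just below it. A
vertex offers three slots, and the rightmost vertex leaves one of its slots empty.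

Lower bound: sorting the points by angle around an extreme point gives a star-shaped polygon through
all of them (`exists_isRadial`). This is a plane Hamiltonian cycle of even length, and its alternate
edges form two matchings.

Convex position: a shortest chord that skips a vertex traps that vertex between its ends, so the
vertex has only its two neighbours along the polygon as possible partners
(`exists_neighbor_consecutive`). Hence `m ≤ 2`.

Five is attained because the icosahedron graph is planar, 5-regular and splits into five perfect
matchings. Explicit integer coordinates reduce this to a finite check. Translated copies placed side
by side, in general position, give arbitrarily large examples. -/

namespace PlaneMatching

/-! ### Orientations and crossing segments -/

/-- Twice the signed area of the triangle `abc`. -/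
def det (a b c : Plane) : ℝ := (b 0 - a 0) * (c 1 - a 1) - (b 1 - a 1) * (c 0 - a 0)

lemma det_swap_right (a b c : Plane) : det a c b = -det a b c := by unfold det; ring

lemma det_rotate (a b c : Plane) : det b c a = det a b c := by unfold det; ring

lemma plane_ext {a b : Plane} (h0 : a 0 = b 0) (h1 : a 1 = b 1) : a = b := by
  ext i; fin_cases i <;> assumption

lemma det_eq_zero_of_collinear {a b c : Plane} (h : Collinear ℝ {a, b, c}) : det a b c = 0 := by
  obtain ⟨p, v, h⟩ := (collinear_iff_exists_forall_eq_smul_vadd _).1 h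
  obtain ⟨r, hr⟩ := h a (by simp)
  obtain ⟨s, hs⟩ := h b (by simp)
  obtain ⟨t, ht⟩ := h c (by simp)
  subst hr hs ht
  simp only [det, vadd_eq_add, PiLp.add_apply, PiLp.smul_apply, smul_eq_mul]
  ring

lemma collinear_of_det_eq_zero {a b c : Plane} (h : det a b c = 0) : Collinear ℝ {a, b, c} := by
  by_cases hab : a = b
  · subst hab; simpa using collinear_pair ℝ a c
  refine (collinear_iff_of_mem (p₀ := a) (by simp)).2 ⟨b - a, ?_⟩
  have key : ∃ r : ℝ, c = r • (b - a) + a := by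
    unfold det at h
    by_cases h0 : b 0 - a 0 = 0
    · have h1 : b 1 - a 1 ≠ 0 := fun h1 => hab (plane_ext (by linarith) (by linarith))
      refine ⟨(c 1 - a 1) / (b 1 - a 1), plane_ext ?_ ?_⟩ <;>
        simp only [PiLp.add_apply, PiLp.smul_apply, PiLp.sub_apply, smul_eq_mul] <;>
        field_simp <;> linarith
    · refine ⟨(c 0 - a 0) / (b 0 - a 0), plane_ext ?_ ?_⟩ <;>
        simp only [PiLp.add_apply, PiLp.smul_apply, PiLp.sub_apply, smul_eq_mul] <;>
        field_simp <;> linarith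
  obtain ⟨r, hr⟩ := key
  rintro q (rfl | rfl | rfl)
  · exact ⟨0, by simp⟩
  · exact ⟨1, by simp⟩
  · exact ⟨r, by simpa using hr⟩

lemma det_combo (u v a b : Plane) {s t : ℝ} (h : s + t = 1) :
    det u v (s • a + t • b) = s * det u v a + t * det u v b := by
  obtain rfl : s = 1 - t := by linarith
  simp only [det, PiLp.add_apply, PiLp.smul_apply, smul_eq_mul]
  ring

lemma det_eq_zero_of_mem_segment {a b q : Plane} (h : q ∈ segment ℝ a b) : det a b q = 0 := by
  obtain ⟨s, t, -, -, hst, rfl⟩ := h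
  rw [det_combo _ _ _ _ hst]
  unfold det; ring

lemma Cross.symm {a b c d : Plane} (h : Cross a b c d) : Cross c d a b := by
  unfold Cross at *; rwa [Set.inter_comm]

lemma cross_swap_left {a b c d : Plane} : Cross b a c d ↔ Cross a b c d := by
  unfold Cross; rw [openSegment_symm]

lemma cross_swap_right {a b c d : Plane} : Cross a b d c ↔ Cross a b c d := by
  unfold Cross; rw [openSegment_symm ℝ c d]

/-- Two segments on the two sides of the line `uv` do not cross, unless they both lie on it. -/
lemma not_cross_of_det_nonneg_of_nonpos (u v : Plane) {a b c d : Plane}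
    (ha : 0 ≤ det u v a) (hb : 0 ≤ det u v b) (hc : det u v c ≤ 0) (hd : det u v d ≤ 0)
    (hne : det u v a ≠ 0 ∨ det u v b ≠ 0 ∨ det u v c ≠ 0 ∨ det u v d ≠ 0) :
    ¬ Cross a b c d := by
  rintro ⟨q, ⟨s, t, hs, ht, hst, rfl⟩, ⟨s', t', hs', ht', hst', h⟩⟩
  have h' := congrArg (det u v) h
  rw [det_combo _ _ _ _ hst, det_combo _ _ _ _ hst'] at h'
  have h1 := mul_nonneg hs.le ha
  have h2 := mul_nonneg ht.le hb
  have h3 := mul_nonpos_of_nonneg_of_nonpos hs'.le hc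
  have h4 := mul_nonpos_of_nonneg_of_nonpos ht'.le hd
  rcases hne with h0 | h0 | h0 | h0
  · exact mul_ne_zero hs.ne' h0 (by linarith)
  · exact mul_ne_zero ht.ne' h0 (by linarith)
  · exact mul_ne_zero hs'.ne' h0 (by linarith)
  · exact mul_ne_zero ht'.ne' h0 (by linarith)

/-- If `c` and `d` lie strictly on the same side of the line `ab`, then `ab` and `cd` do not
cross. -/
lemma not_cross_of_same_side {a b c d : Plane} (h : 0 < det a b c * det a b d) :
    ¬ Cross a b c d := by
  have ha : det a b a = 0 := by unfold det; ring
  have hb : det a b b = 0 := by unfold det; ring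
  rcases pos_and_pos_or_neg_and_neg_of_mul_pos h with ⟨h1, h2⟩ | ⟨h1, h2⟩
  · exact fun hx => not_cross_of_det_nonneg_of_nonpos a b h1.le h2.le ha.le hb.le
      (Or.inl h1.ne') hx.symm
  · exact not_cross_of_det_nonneg_of_nonpos a b ha.ge hb.ge h1.le h2.le
      (Or.inr (Or.inr (Or.inl h1.ne)))

lemma not_cross_of_common_endpoint {a b c : Plane} (h : det a b c ≠ 0) : ¬ Cross a b a c := by
  have ha : det a b a = 0 := by unfold det; ring
  have hb : det a b b = 0 := by unfold det; ring
  rcases lt_or_gt_of_ne h with h | h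
  · exact not_cross_of_det_nonneg_of_nonpos a b ha.ge hb.ge ha.le h.le
      (Or.inr (Or.inr (Or.inr h.ne)))
  · exact fun hx => not_cross_of_det_nonneg_of_nonpos a b ha.ge h.le ha.le hb.le
      (Or.inr (Or.inl h.ne')) hx.symm

lemma cross_of_opposite_sides {a b c d : Plane} (h1 : det a b c * det a b d < 0)
    (h2 : det c d a * det c d b < 0) : Cross a b c d := by
  have key : ∀ x y : ℝ, x * y < 0 → 0 < x / (x - y) ∧ 0 < -y / (x - y) ∧ x - y ≠ 0 := by
    intro x y h
    rcases mul_neg_iff.1 h with ⟨hx, hy⟩ | ⟨hx, hy⟩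
    · exact ⟨div_pos hx (by linarith), div_pos (by linarith) (by linarith), by linarith⟩
    · exact ⟨div_pos_of_neg_of_neg hx (by linarith),
        div_pos_of_neg_of_neg (by linarith) (by linarith), by linarith⟩
  obtain ⟨p1, p2, p3⟩ := key _ _ h1
  obtain ⟨q1, q2, q3⟩ := key _ _ h2
  have hden : det c d b - det c d a = det a b c - det a b d := by unfold det; ring
  -- The weights are those for which the affine function `det c d` vanishes at the point; `hden`
  -- identifies it with the point of `cd` where `det a b` vanishes.
  refine ⟨(-det c d b / (det c d a - det c d b)) • a + (det c d a / (det c d a - det c d b)) • b,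
    ⟨_, _, q2, q1, by field_simp; ring, rfl⟩,
    ⟨_, _, p2, p1, by field_simp; ring, ?_⟩⟩
  have e : det c d a - det c d b = -(det a b c - det a b d) := by linarith
  rw [e]
  refine plane_ext ?_ ?_ <;>
    simp only [PiLp.add_apply, PiLp.smul_apply, smul_eq_mul] <;>
    field_simp <;> unfold det <;> ring

/-! ### Packings as families of involutions -/

/-- General position of an indexed family of points. -/
def InGeneralPosition {ι : Type*} (p : ι → Plane) : Prop :=
  ∀ a b c : ι, a ≠ b → a ≠ c → b ≠ c → det (p a) (p b) (p c) ≠ 0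

/-- The involutions `f 0, …, f (m - 1)` are the matchings of a packing into an indexed family of
points. -/
structure IsPacking {ι : Type*} (p : ι → Plane) {m : ℕ} (f : Fin m → ι → ι) : Prop where
  inv : ∀ i a, f i (f i a) = a
  ne : ∀ i a, f i a ≠ a
  disj : ∀ i j a, i ≠ j → f i a ≠ f j a
  noncross : ∀ i j a b, s(a, f i a) ≠ s(b, f j b) → ¬ Cross (p a) (p (f i a)) (p b) (p (f j b))

/-- Distinct edges with a common endpoint cannot cross in general position, so only pairs with four
distinct endpoints remain to be checked. The proof disposes of the four ways to share an endpoint.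
-/
lemma InGeneralPosition.isPacking {ι : Type*} {p : ι → Plane} (hp : InGeneralPosition p) {m : ℕ}
    {f : Fin m → ι → ι} (inv : ∀ i a, f i (f i a) = a) (ne : ∀ i a, f i a ≠ a)
    (disj : ∀ i j a, i ≠ j → f i a ≠ f j a)
    (noncross : ∀ i j a b, a ≠ b → a ≠ f j b → f i a ≠ b → f i a ≠ f j b →
      ¬ Cross (p a) (p (f i a)) (p b) (p (f j b))) : IsPacking p f := by
  refine ⟨inv, ne, disj, fun i j a b h => ?_⟩
  have common : ∀ a b c, a ≠ b → a ≠ c → b ≠ c → ¬ Cross (p a) (p b) (p a) (p c) :=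
    fun a b c h1 h2 h3 => not_cross_of_common_endpoint (hp a b c h1 h2 h3)
  have hi := ne i a
  have hj := ne j b
  by_cases h1 : a = b
  · subst h1
    exact common _ _ _ hi.symm hj.symm (fun e => h (by rw [e]))
  by_cases h2 : a = f j b
  · rw [cross_swap_right, ← h2]
    exact common _ _ _ hi.symm h1 (fun e => h (by rw [e, ← h2, Sym2.eq_swap]))
  by_cases h3 : f i a = b
  · rw [cross_swap_left, ← h3]
    rw [← h3] at hj h2
    exact common _ _ _ hi hj.symm h2
  by_cases h4 : f i a = f j b
  · rw [cross_swap_left, cross_swap_right, ← h4]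
    exact common _ _ _ hi h3 h1
  exact noncross i j a b h1 h2 h3 h4

section Transfer

variable {P : Finset Plane} {ι : Type*}

lemma generalPosition_iff (e : ι ≃ P) :
    GeneralPosition P ↔ InGeneralPosition (fun a => (e a : Plane)) := by
  constructor
  · intro h a b c h1 h2 h3 h0
    exact h _ (e a).2 _ (e b).2 _ (e c).2 (by simpa [Subtype.ext_iff] using e.injective.ne h1)
      (by simpa [Subtype.ext_iff] using e.injective.ne h2)
      (by simpa [Subtype.ext_iff] using e.injective.ne h3) (collinear_of_det_eq_zero h0)
  · intro h a ha b hb c hc h1 h2 h3 h0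
    refine h (e.symm ⟨a, ha⟩) (e.symm ⟨b, hb⟩) (e.symm ⟨c, hc⟩) ?_ ?_ ?_ ?_
    · simpa using h1
    · simpa using h2
    · simpa using h3
    · simpa using det_eq_zero_of_collinear h0

/-- In general position, non-crossing segments without common endpoints are disjoint. -/
lemma disjoint_segment_of_not_cross {a b c d : Plane} (h : ¬ Cross a b c d)
    (ha : det c d a ≠ 0) (hb : det c d b ≠ 0) (hc : det a b c ≠ 0) (hd : det a b d ≠ 0) :
    Disjoint (segment ℝ a b) (segment ℝ c d) := by
  rw [Set.disjoint_left]
  intro q h1 h2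
  have e1 := det_eq_zero_of_mem_segment h1
  have e2 := det_eq_zero_of_mem_segment h2
  rw [← insert_endpoints_openSegment] at h1 h2
  rcases h1 with rfl | rfl | h1
  · exact ha e2
  · exact hb e2
  rcases h2 with rfl | rfl | h2
  · exact hc e1
  · exact hd e1
  exact h ⟨q, h1, h2⟩

/-- The geometric graph of a fixed-point free involution of the index set. -/
def matchingOf (e : ι ≃ P) (g : ι → ι) (inv : ∀ a, g (g a) = a) (ne : ∀ a, g a ≠ a) :
    GeometricGraph P where
  verts := Set.univ
  Adj u v := v = e (g (e.symm u))
  adj_sub := by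
    rintro u v rfl
    rw [SimpleGraph.top_adj]
    intro h
    exact ne (e.symm u) (by simpa using (congrArg e.symm h).symm)
  edge_vert _ := Set.mem_univ _
  symm := ⟨by rintro u v rfl; simp [inv]⟩

lemma IsPacking.canPack {m : ℕ} {f : Fin m → ι → ι} (e : ι ≃ P)
    (hP : InGeneralPosition (fun a => (e a : Plane)))
    (h : IsPacking (fun a => (e a : Plane)) f) : CanPack P m := by
  refine ⟨fun i => matchingOf e (f i) (h.inv i) (h.ne i), fun i => ⟨⟨?_, ?_⟩, ?_⟩, ?_⟩
  · intro v _
    exact ⟨e (f i (e.symm v)), rfl, fun y hy => hy⟩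
  · exact fun v => Set.mem_univ v
  · intro a b c d hab hcd hne
    obtain ⟨a, rfl⟩ := e.surjective a
    obtain ⟨c, rfl⟩ := e.surjective c
    change b = _ at hab
    change d = _ at hcd
    rw [e.symm_apply_apply] at hab hcd
    subst hab hcd
    have hne' : s(a, f i a) ≠ s(c, f i c) := fun h0 => by
      refine hne ?_
      simpa using congrArg (Sym2.map e) h0
    have h1 : a ≠ c := fun h0 => hne' (by rw [h0])
    have h2 : a ≠ f i c := fun h0 => hne' (by rw [h0, h.inv, Sym2.eq_swap])
    have h3 : f i a ≠ c := fun h0 => hne' (by rw [← h0, h.inv, Sym2.eq_swap])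
    have h4 : f i a ≠ f i c := fun h0 => h1 (by rw [← h.inv i a, h0, h.inv])
    exact disjoint_segment_of_not_cross (h.noncross i i a c hne')
      (hP _ _ _ (h.ne i c).symm h1.symm h2.symm) (hP _ _ _ (h.ne i c).symm h3.symm h4.symm)
      (hP _ _ _ (h.ne i a).symm h1 h3) (hP _ _ _ (h.ne i a).symm h2 h4)
  · intro i j hij
    constructor
    · refine Set.disjoint_left.2 fun x => ?_
      induction x using Sym2.ind with
      | _ u v =>
        rw [SimpleGraph.Subgraph.mem_edgeSet, SimpleGraph.Subgraph.mem_edgeSet]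
        intro h1 h2
        change v = _ at h1
        change v = _ at h2
        exact h.disj i j (e.symm u) hij (e.injective (h1.symm.trans h2))
    · intro a b c d hab hcd
      obtain ⟨a, rfl⟩ := e.surjective a
      obtain ⟨c, rfl⟩ := e.surjective c
      change b = _ at hab
      change d = _ at hcd
      rw [e.symm_apply_apply] at hab hcd
      subst hab hcd
      refine h.noncross i j a c fun h0 => ?_
      rcases Sym2.eq_iff.1 h0 with ⟨h1, h2⟩ | ⟨h1, h2⟩
      · subst h1; exact h.disj i j a hij h2
      · subst h2; exact h.disj i j _ hij ((h.inv i a).trans h1)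

lemma CanPack.exists_isPacking {m : ℕ} (e : ι ≃ P) (h : CanPack P m) :
    ∃ f : Fin m → ι → ι, IsPacking (fun a => (e a : Plane)) f := by
  obtain ⟨M, hM, hd⟩ := h
  have hex : ∀ i a, ∃ b, (M i).Adj (e a) (e b) := by
    intro i a
    obtain ⟨v, hv, -⟩ := (hM i).1.1 ((hM i).1.2 (e a))
    exact ⟨e.symm v, by simpa using hv⟩
  choose f hf using hex
  have uniq : ∀ i a b, (M i).Adj (e a) (e b) → b = f i a := by
    intro i a b hab
    exact e.injective (((hM i).1.1 ((hM i).1.2 (e a))).unique hab (hf i a))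
  refine ⟨f, ⟨fun i a => (uniq _ _ _ (hf i a).symm).symm, fun i a h0 => ?_, fun i j a hij h0 => ?_,
    fun i j a b hne => ?_⟩⟩
  · exact (hf i a).ne (by rw [h0])
  · have h1 : s(e a, e (f i a)) ∈ (M i).edgeSet := hf i a
    refine Set.disjoint_left.1 (hd i j hij).1 h1 ?_
    rw [h0]
    exact hf j a
  -- For `i = j` this is planarity of a single matching, otherwise the non-crossing of two of them.
  · by_cases hij : i = j
    · subst hij
      have := (hM i).2 _ _ _ _ (hf i a) (hf i b) (fun h0 => hne ?_)
      · rintro ⟨q, h1, h2⟩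
        exact Set.disjoint_left.1 this (openSegment_subset_segment _ _ _ h1)
          (openSegment_subset_segment _ _ _ h2)
      · simpa using congrArg (Sym2.map e.symm) h0
    · exact (hd i j hij).2 _ _ _ _ (hf i a) (hf j b)

end Transfer

/-! ### Fewer than `3 * n` edges, by charging edges to vertices -/

section PlaneGraph

variable {ι : Type*}

/-- The slope of the edge `e` in the drawing with coordinate functions `x` and `y`. -/
noncomputable def slope (x y : ι → ℝ) (e : ι × ι) : ℝ := (y e.2 - y e.1) / (x e.2 - x e.1)

/-- The height of the line through the edge `e` above the abscissa `X`. -/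
noncomputable def height (x y : ι → ℝ) (e : ι × ι) (X : ℝ) : ℝ :=
  y e.1 + slope x y e * (X - x e.1)

/-- A straight-line drawing of a plane graph without vertical edges; every edge is listed once,
as the pair of its left and its right endpoint. -/
structure IsPlaneDrawing (x y : ι → ℝ) (E : Finset (ι × ι)) : Prop where
  inj : Function.Injective x
  lt : ∀ e ∈ E, x e.1 < x e.2
  noncross : ∀ e ∈ E, ∀ f ∈ E, e ≠ f → ∀ X, x e.1 < X → X < x e.2 → x f.1 < X → X < x f.2 →
    height x y e X ≠ height x y f X
  novertex : ∀ e ∈ E, ∀ c, x e.1 < x c → x c < x e.2 → height x y e (x c) ≠ y c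

/-- The edges `e` and `f` leave their common left endpoint to the right, `f` directly above `e`. -/
structure IsWedge (x y : ι → ℝ) (E : Finset (ι × ι)) (e f : ι × ι) : Prop where
  left_mem : e ∈ E
  right_mem : f ∈ E
  fst_eq : e.1 = f.1
  slope_lt : slope x y e < slope x y f
  consecutive : ∀ g ∈ E, g.1 = e.1 → ¬ (slope x y e < slope x y g ∧ slope x y g < slope x y f)

/-- The vertex `c` lies in the wedge between `e` and `f`. -/
structure InWedge (x y : ι → ℝ) (e f : ι × ι) (c : ι) : Prop where
  lt : x e.1 < x c
  le_left : x c ≤ x e.2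
  le_right : x c ≤ x f.2
  above : height x y e (x c) ≤ y c
  below : y c ≤ height x y f (x c)

/-- The vertex `r` is the leftmost vertex in the wedge between `e` and `f`. -/
def IsFirst (x y : ι → ℝ) (e f : ι × ι) (r : ι) : Prop :=
  InWedge x y e f r ∧ ∀ c, InWedge x y e f c → x r ≤ x c

variable {x y : ι → ℝ} {E : Finset (ι × ι)}

lemma height_fst (e : ι × ι) : height x y e (x e.1) = y e.1 := by simp [height]

lemma height_snd {e : ι × ι} (h : x e.1 < x e.2) : height x y e (x e.2) = y e.2 := by
  have : x e.2 - x e.1 ≠ 0 := by linarith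
  unfold height slope
  field_simp
  ring

lemma slope_neg (e : ι × ι) : slope x (-y) e = -slope x y e := by
  simp only [slope, Pi.neg_apply]; ring

lemma height_neg (e : ι × ι) (X : ℝ) : height x (-y) e X = -height x y e X := by
  simp only [height, slope_neg, Pi.neg_apply]; ring

lemma IsPlaneDrawing.neg (h : IsPlaneDrawing x y E) : IsPlaneDrawing x (-y) E where
  inj := h.inj
  lt := h.lt
  noncross e he f hf hne X h1 h2 h3 h4 h0 := by
    rw [height_neg, height_neg] at h0
    exact h.noncross e he f hf hne X h1 h2 h3 h4 (neg_injective h0)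
  novertex e he c h1 h2 h0 := by
    rw [height_neg] at h0
    exact h.novertex e he c h1 h2 (neg_injective h0)

/-- Reflection in the horizontal axis exchanges the two sides of a wedge. It turns statements about
upper edges into statements about lower edges. -/
lemma IsWedge.neg {e f : ι × ι} (h : IsWedge x y E e f) : IsWedge x (-y) E f e where
  left_mem := h.right_mem
  right_mem := h.left_mem
  fst_eq := h.fst_eq.symm
  slope_lt := by rw [slope_neg, slope_neg]; exact neg_lt_neg h.slope_lt
  consecutive g hg h1 := by
    simp only [slope_neg, neg_lt_neg_iff]
    exact fun h2 => h.consecutive g hg (h1.trans h.fst_eq.symm) h2.symm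

lemma inWedge_neg {e f : ι × ι} (he : e.1 = f.1) {c : ι} :
    InWedge x (-y) f e c ↔ InWedge x y e f c := by
  constructor
  · rintro ⟨h1, h2, h3, h4, h5⟩
    simp only [height_neg, Pi.neg_apply, neg_le_neg_iff] at h4 h5
    exact ⟨he ▸ h1, h3, h2, h5, h4⟩
  · rintro ⟨h1, h2, h3, h4, h5⟩
    refine ⟨he ▸ h1, h3, h2, ?_, ?_⟩ <;> simpa only [height_neg, Pi.neg_apply, neg_le_neg_iff]

lemma IsFirst.neg {e f : ι × ι} (he : e.1 = f.1) {r : ι} (h : IsFirst x y e f r) :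
    IsFirst x (-y) f e r :=
  ⟨(inWedge_neg he).2 h.1, fun c hc => h.2 c ((inWedge_neg he).1 hc)⟩

lemma height_lt_height_iff {e f : ι × ι} (h : e.1 = f.1) {X : ℝ} (hX : x e.1 < X) :
    height x y e X < height x y f X ↔ slope x y e < slope x y f := by
  unfold height
  rw [← h, add_lt_add_iff_left, mul_lt_mul_iff_left₀ (sub_pos.2 hX)]

/-- Two edges do not change their vertical order where both of them are defined. -/
lemma IsPlaneDrawing.height_le_of_lt (h : IsPlaneDrawing x y E) {e f : ι × ι} (he : e ∈ E)
    (hf : f ∈ E) {X₀ X : ℝ} (h0 : X₀ < X) (e0 : x e.1 ≤ X₀) (e1 : X ≤ x e.2) (f0 : x f.1 ≤ X₀)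
    (f1 : X ≤ x f.2) (hlt : height x y e X < height x y f X) :
    height x y e X₀ ≤ height x y f X₀ := by
  by_contra! hcon
  have hne : e ≠ f := by rintro rfl; exact lt_irrefl _ hlt
  set d0 := height x y e X₀ - height x y f X₀ with hd0
  set d1 := height x y f X - height x y e X with hd1
  have p0 : 0 < d0 := sub_pos.2 hcon
  have p1 : 0 < d1 := sub_pos.2 hlt
  have ps : d0 + d1 ≠ 0 := by positivity
  have q0 : 0 < (X - X₀) * (d0 / (d0 + d1)) := mul_pos (sub_pos.2 h0) (by positivity)
  have q1 : 0 < (X - X₀) * (d1 / (d0 + d1)) := mul_pos (sub_pos.2 h0) (by positivity)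
  have q2 : (X - X₀) * (d0 / (d0 + d1)) + (X - X₀) * (d1 / (d0 + d1)) = X - X₀ := by
    field_simp
  -- If the order changed, the two lines would meet at the abscissa dividing `[X₀, X]` in the ratio
  -- `d0 : d1` of the two gaps, and the edges would cross there.
  refine h.noncross e he f hf hne (X₀ + (X - X₀) * (d0 / (d0 + d1))) (by linarith)
    (by linarith) (by linarith) (by linarith) ?_
  have hs : (slope x y f - slope x y e) * (X - X₀) = d0 + d1 := by
    rw [hd0, hd1]; unfold height; ring
  have : height x y e (X₀ + (X - X₀) * (d0 / (d0 + d1)))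
      - height x y f (X₀ + (X - X₀) * (d0 / (d0 + d1)))
      = d0 - (slope x y f - slope x y e) * (X - X₀) * (d0 / (d0 + d1)) := by
    rw [hd0]; unfold height; ring
  have q3 : (d0 + d1) * (d0 / (d0 + d1)) = d0 := by field_simp
  rw [hs, q3] at this
  linarith

lemma IsFirst.lt_snd (h : IsPlaneDrawing x y E) {e f : ι × ι} (hw : IsWedge x y E e f) {r : ι}
    (hr : IsFirst x y e f r) (hlt : y r < height x y f (x r)) : x r < x f.2 := by
  refine lt_of_le_of_ne hr.1.le_right fun h0 => ?_
  rw [h0, height_snd (h.lt f hw.right_mem), h.inj h0] at hlt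
  exact lt_irrefl _ hlt

/-- A wedge whose leftmost vertex lies strictly below its upper edge is determined by that
vertex. -/
lemma IsPlaneDrawing.upper_edge_unique (h : IsPlaneDrawing x y E) {e f e' f' : ι × ι} {r : ι}
    (hw : IsWedge x y E e f) (hr : IsFirst x y e f r) (hlt : y r < height x y f (x r))
    (hw' : IsWedge x y E e' f') (hr' : IsFirst x y e' f' r)
    (hlt' : y r < height x y f' (x r)) : f = f' := by
  wlog hv : x e.1 ≤ x e'.1 generalizing e f e' f'
  · exact (this hw' hr' hlt' hw hr hlt (le_of_not_ge hv)).symm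
  by_contra hne
  have hf := hw.fst_eq
  have hf' := hw'.fst_eq
  have r1 := hr.lt_snd h hw hlt
  have r1' := hr'.lt_snd h hw' hlt'
  have r2 := hr.1.lt
  have r2' := hr'.1.lt
  have s0 := hr.1.above
  have s0' := hr'.1.above
  have t0 := hr.1.le_left
  have t0' := hr'.1.le_left
  have z' : height x y f' (x e'.1) = y e'.1 := by rw [hf', height_fst]
  rcases lt_trichotomy (height x y f' (x r)) (height x y f (x r)) with hc | hc | hc
  -- Above `x r` the order is `e`, `f'`, `f`. Followed back to the apex of the second wedge, this
  -- puts that apex inside the first wedge, to the left of `r`; if the apexes coincide, `f'`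
  -- separates `e` from `f`.
  · have k1 := h.height_le_of_lt hw.left_mem hw'.right_mem r2' hv t0 (by rw [hf']) r1'.le
      (lt_of_le_of_lt s0 hlt')
    have k2 := h.height_le_of_lt hw'.right_mem hw.right_mem r2' (by rw [hf']) r1'.le
      (by rwa [← hf]) r1.le hc
    rcases hv.lt_or_eq with hv | hv
    · have := hr.2 e'.1 ⟨hv, by linarith, by linarith, by linarith, by linarith⟩
      linarith
    · have hv := h.inj hv
      refine hw.consecutive f' hw'.right_mem (by rw [← hf', hv]) ⟨?_, ?_⟩
      · exact (height_lt_height_iff (by rw [hv, hf']) r2).1 (lt_of_le_of_lt s0 hlt')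
      · exact (height_lt_height_iff (by rw [← hf', ← hf, hv]) (by rwa [← hf'])).1 hc
  · exact h.noncross f hw.right_mem f' hw'.right_mem hne (x r) (by rwa [← hf]) r1
      (by rwa [← hf']) r1' hc.symm
  -- Now the order above `x r` is `e'`, `f`, `f'`. At the apex of the second wedge `f` is squeezed
  -- between two edges that meet there, so it passes through a vertex; if the apexes coincide, `f`
  -- separates `e'` from `f'`.
  · have k1 := h.height_le_of_lt hw.right_mem hw'.right_mem r2' (by rwa [← hf]) r1.le
      (by rw [hf']) r1'.le hc
    have k2 := h.height_le_of_lt hw'.left_mem hw.right_mem r2' le_rfl t0' (by rwa [← hf]) r1.le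
      (lt_of_le_of_lt s0' hlt)
    rw [height_fst] at k2
    rcases hv.lt_or_eq with hv | hv
    · exact h.novertex f hw.right_mem e'.1 (by rwa [← hf]) (by linarith) (by linarith)
    · have hv := h.inj hv
      refine hw'.consecutive f hw.right_mem (by rw [← hf, hv]) ⟨?_, ?_⟩
      · exact (height_lt_height_iff (by rw [← hf, hv]) r2').1 (lt_of_le_of_lt s0' hlt)
      · exact (height_lt_height_iff (by rw [← hf', ← hf, hv]) (by rwa [← hf])).1 hc

lemma IsPlaneDrawing.eq_of_slope_eq (h : IsPlaneDrawing x y E) {e f : ι × ι} (he : e ∈ E)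
    (hf : f ∈ E) (h1 : e.1 = f.1) (hs : slope x y e = slope x y f) : e = f := by
  by_contra hne
  have a := h.lt e he
  have b := h.lt f hf
  rw [← h1] at b
  obtain ⟨X, hX, hX'⟩ := exists_between (lt_min a b)
  rw [lt_min_iff] at hX'
  refine h.noncross e he f hf hne X hX hX'.1 (h1 ▸ hX) hX'.2 ?_
  unfold height
  rw [hs, h1]

lemma IsWedge.eq_of_left_eq (h : IsPlaneDrawing x y E) {e f f' : ι × ι}
    (hw : IsWedge x y E e f) (hw' : IsWedge x y E e f') : f = f' := by
  have h1 : f.1 = f'.1 := hw.fst_eq.symm.trans hw'.fst_eq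
  rcases lt_trichotomy (slope x y f) (slope x y f') with hc | hc | hc
  · exact absurd ⟨hw.slope_lt, hc⟩ (hw'.consecutive f hw.right_mem hw.fst_eq.symm)
  · exact h.eq_of_slope_eq hw.right_mem hw'.right_mem h1 hc
  · exact absurd ⟨hw'.slope_lt, hc⟩ (hw.consecutive f' hw'.right_mem hw'.fst_eq.symm)

/-- By reflection the lower edges agree, and an edge has only one edge directly above it at its left
endpoint. -/
lemma IsPlaneDrawing.lower_edge_unique (h : IsPlaneDrawing x y E) {e f e' f' : ι × ι} {r : ι}
    (hw : IsWedge x y E e f) (hr : IsFirst x y e f r) (hlt : height x y e (x r) < y r)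
    (hw' : IsWedge x y E e' f') (hr' : IsFirst x y e' f' r)
    (hlt' : height x y e' (x r) < y r) : f = f' := by
  have : e = e' := h.neg.upper_edge_unique hw.neg (hr.neg hw.fst_eq)
    (by rw [height_neg]; exact neg_lt_neg hlt) hw'.neg (hr'.neg hw'.fst_eq)
    (by rw [height_neg]; exact neg_lt_neg hlt')
  subst this
  exact hw.eq_of_left_eq h hw'

lemma IsPlaneDrawing.exists_isWedge {f g : ι × ι} (hf : f ∈ E)
    (hg : g ∈ E) (h1 : g.1 = f.1) (hlt : slope x y g < slope x y f) :
    ∃ e, IsWedge x y E e f := by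
  classical
  obtain ⟨e, he, hmax⟩ := Finset.exists_max_image
    (E.filter fun e => e.1 = f.1 ∧ slope x y e < slope x y f) (slope x y)
    ⟨g, by simp [hg, h1, hlt]⟩
  simp only [Finset.mem_filter] at he hmax
  refine ⟨e, he.1, hf, he.2.1, he.2.2, fun k hk hk1 hk2 => ?_⟩
  have := hmax k ⟨hk, hk1.trans he.2.1, hk2.2⟩
  linarith [hk2.1]

/-- The wedge is not empty: of the right endpoints of its two edges, the one further left belongs to
it. -/
lemma IsPlaneDrawing.exists_isFirst [Finite ι] (h : IsPlaneDrawing x y E) {e f : ι × ι}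
    (hw : IsWedge x y E e f) : ∃ r, IsFirst x y e f r := by
  have a := h.lt e hw.left_mem
  have b := h.lt f hw.right_mem
  have hne : {c | InWedge x y e f c}.Nonempty := by
    rcases le_total (x e.2) (x f.2) with hc | hc
    · refine ⟨e.2, a, le_rfl, hc, (height_snd a).le, ?_⟩
      rw [← height_snd (y := y) a]
      exact ((height_lt_height_iff hw.fst_eq a).2 hw.slope_lt).le
    · refine ⟨f.2, hw.fst_eq ▸ b, hc, le_rfl, ?_, (height_snd b).ge⟩
      rw [← height_snd (y := y) b]
      exact ((height_lt_height_iff hw.fst_eq (hw.fst_eq ▸ b)).2 hw.slope_lt).le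
  obtain ⟨r, hr, hmin⟩ := Set.exists_min_image _ x (Set.toFinite _) hne
  exact ⟨r, hr, hmin⟩

/-- The edge `f` is charged to `c`: to its left endpoint, or to the leftmost vertex in the wedge
below `f`, from above or from below. -/
def IsCharged (x y : ι → ℝ) (E : Finset (ι × ι)) (f : ι × ι) : ι ⊕ ι × Bool → Prop
  | .inl v => f.1 = v ∧ ∀ g ∈ E, g.1 = f.1 → slope x y f ≤ slope x y g
  | .inr (r, true) =>
    ∃ e, IsWedge x y E e f ∧ IsFirst x y e f r ∧ y r < height x y f (x r)
  | .inr (r, false) =>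
    ∃ e, IsWedge x y E e f ∧ IsFirst x y e f r ∧ height x y e (x r) < y r

/-- The lowest edge at its left endpoint is charged there. For any other edge, the first vertex of
its wedge cannot lie on both sides of the wedge, since these meet only at the apex. -/
lemma IsPlaneDrawing.exists_isCharged [Finite ι] (h : IsPlaneDrawing x y E) {f : ι × ι}
    (hf : f ∈ E) : ∃ c, IsCharged x y E f c := by
  by_cases hlow : ∀ g ∈ E, g.1 = f.1 → slope x y f ≤ slope x y g
  · exact ⟨.inl f.1, rfl, hlow⟩
  push Not at hlow
  obtain ⟨g, hg, h1, hlt⟩ := hlow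
  obtain ⟨e, hw⟩ := exists_isWedge hf hg h1 hlt
  obtain ⟨r, hr⟩ := h.exists_isFirst hw
  rcases hr.1.below.lt_or_eq with hc | hc
  · exact ⟨.inr (r, true), e, hw, hr, hc⟩
  · refine ⟨.inr (r, false), e, hw, hr, ?_⟩
    rw [hc]
    exact (height_lt_height_iff hw.fst_eq hr.1.lt).2 hw.slope_lt

lemma IsPlaneDrawing.isCharged_unique (h : IsPlaneDrawing x y E) {f f' : ι × ι} (hf : f ∈ E)
    (hf' : f' ∈ E) {c : ι ⊕ ι × Bool} (hc : IsCharged x y E f c) (hc' : IsCharged x y E f' c) :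
    f = f' := by
  rcases c with v | ⟨r, b⟩
  · obtain ⟨h1, h2⟩ := hc
    obtain ⟨h1', h2'⟩ := hc'
    have h3 := h1.trans h1'.symm
    exact h.eq_of_slope_eq hf hf' h3 (le_antisymm (h2 _ hf' h3.symm) (h2' _ hf h3))
  · cases b
    · obtain ⟨e, h1, h2, h3⟩ := hc
      obtain ⟨e', h1', h2', h3'⟩ := hc'
      exact h.lower_edge_unique h1 h2 h3 h1' h2' h3'
    · obtain ⟨e, h1, h2, h3⟩ := hc
      obtain ⟨e', h1', h2', h3'⟩ := hc'
      exact h.upper_edge_unique h1 h2 h3 h1' h2' h3'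

/-- A straight-line plane graph on `n` vertices has fewer than `3 * n` edges. -/
theorem IsPlaneDrawing.card_lt [Fintype ι] [Nonempty ι] (h : IsPlaneDrawing x y E) :
    E.card < 3 * Fintype.card ι := by
  classical
  have hex : ∀ f : E, ∃ c, IsCharged x y E f c := fun f => h.exists_isCharged f.2
  choose c hc using hex
  obtain ⟨t, -, ht⟩ := Finset.exists_max_image (Finset.univ : Finset ι) x Finset.univ_nonempty
  have hinj : Function.Injective c := fun f f' hff =>
    Subtype.ext (h.isCharged_unique f.2 f'.2 (hc f) (hff ▸ hc f'))
  -- No edge leaves the rightmost vertex `t` to the right, which makes the bound strict.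
  have hnot : Sum.inl t ∉ Set.range c := by
    rintro ⟨f, hf⟩
    have h1 := hc f
    rw [hf] at h1
    have h2 := h.lt f f.2
    rw [h1.1] at h2
    exact absurd (ht _ (Finset.mem_univ _)) (not_le.2 h2)
  have h1 := Fintype.card_lt_of_injective_of_notMem c hinj hnot
  simp only [Fintype.card_coe, Fintype.card_sum, Fintype.card_prod, Fintype.card_bool] at h1
  omega

end PlaneGraph

/-! ### At most five matchings -/

/-- The shear of the plane that sends `(1, 0)` to itself and adds `t` times the ordinate to the
abscissa. -/
def shear (t : ℝ) (q : Plane) : ℝ := q 0 + t * q 1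

/-- Two points with different ordinates get equal abscissae for exactly one `t`, and distinct points
with equal ordinates for none. Avoiding finitely many values therefore removes all vertical edges.
-/
lemma exists_shear_injective {ι : Type*} [Finite ι] {p : ι → Plane} (hp : Function.Injective p) :
    ∃ t, Function.Injective fun a => shear t (p a) := by
  have hfin : (Set.range fun ab : ι × ι =>
      (p ab.1 0 - p ab.2 0) / (p ab.2 1 - p ab.1 1)).Finite := Set.finite_range _
  obtain ⟨t, ht⟩ := hfin.infinite_compl.nonempty
  refine ⟨t, fun a b hab => ?_⟩
  by_contra hne
  simp only [shear] at hab
  by_cases h1 : p b 1 - p a 1 = 0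
  · have h1' : p a 1 = p b 1 := by linarith
    rw [h1'] at hab
    exact hne (hp (plane_ext (by linarith) h1'))
  · refine ht ⟨(a, b), ?_⟩
    simp only
    field_simp
    linarith

lemma height_eq_combo {ι : Type*} {x y : ι → ℝ} {a b : ι} {X : ℝ} (h1 : x a < X)
    (h2 : X < x b) : ∃ s t, 0 < s ∧ 0 < t ∧ s + t = 1 ∧ s * x a + t * x b = X ∧
      s * y a + t * y b = height x y (a, b) X := by
  have hd : x b - x a ≠ 0 := by linarith
  refine ⟨(x b - X) / (x b - x a), (X - x a) / (x b - x a),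
    div_pos (by linarith) (by linarith), div_pos (by linarith) (by linarith), ?_, ?_, ?_⟩
  · field_simp; ring
  · field_simp; ring
  · unfold height slope
    field_simp
    ring

lemma shear_combo (t : ℝ) (a b : Plane) (r s : ℝ) :
    shear t (r • a + s • b) = r * shear t a + s * shear t b := by
  simp only [shear, PiLp.add_apply, PiLp.smul_apply, smul_eq_mul]; ring

lemma shear_ext {t : ℝ} {a b : Plane} (h0 : shear t a = shear t b) (h1 : a 1 = b 1) : a = b := by
  unfold shear at h0
  rw [h1] at h0
  exact plane_ext (by linarith) h1

lemma exists_mem_openSegment {ι : Type*} {p : ι → Plane} {t : ℝ} {a b : ι} {X : ℝ}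
    (h1 : shear t (p a) < X) (h2 : X < shear t (p b)) :
    ∃ q ∈ openSegment ℝ (p a) (p b), shear t q = X ∧
      q 1 = height (fun a => shear t (p a)) (fun a => p a 1) (a, b) X := by
  obtain ⟨r, s, hr, hs, hrs, e1, e2⟩ :=
    height_eq_combo (x := fun a => shear t (p a)) (y := fun a => p a 1) h1 h2
  refine ⟨r • p a + s • p b, ⟨r, s, hr, hs, hrs, rfl⟩, ?_, ?_⟩
  · rw [shear_combo]; exact e1
  · rw [← e2]; simp

section UpperBound

variable {ι : Type*} [Fintype ι] {p : ι → Plane} {m : ℕ} {f : Fin m → ι → ι}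

open Classical in
/-- The edges of a packing, directed to the right. -/
noncomputable def rightEdges (x : ι → ℝ) (f : Fin m → ι → ι) : Finset (ι × ι) :=
  (Finset.univ.filter fun ia : Fin m × ι => x ia.2 < x (f ia.1 ia.2)).image
    fun ia => (ia.2, f ia.1 ia.2)

/-- Each `f i` exchanges left and right endpoints, so exactly half of the `m * n` pairs (matching,
vertex) start at a left endpoint; edge-disjointness prevents double counting. -/
lemma IsPacking.card_rightEdges (h : IsPacking p f) {x : ι → ℝ} (hx : Function.Injective x) :
    2 * (rightEdges x f).card = m * Fintype.card ι := by
  classical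
  have h1 : (rightEdges x f).card
      = (Finset.univ.filter fun ia : Fin m × ι => x ia.2 < x (f ia.1 ia.2)).card := by
    refine Finset.card_image_of_injective _ ?_
    rintro ⟨i, a⟩ ⟨j, b⟩ hab
    simp only [Prod.mk.injEq] at hab
    obtain ⟨rfl, hab⟩ := hab
    by_contra hne
    exact h.disj i j a (fun hij => hne (by rw [hij])) hab
  have h2 : (Finset.univ.filter fun ia : Fin m × ι => ¬ x ia.2 < x (f ia.1 ia.2)).card
      = (Finset.univ.filter fun ia : Fin m × ι => x ia.2 < x (f ia.1 ia.2)).card := by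
    refine Finset.card_bij (fun ia _ => (ia.1, f ia.1 ia.2)) ?_ ?_ ?_
    · rintro ⟨i, a⟩ ha
      simp only [Finset.mem_filter, Finset.mem_univ, true_and, not_lt, h.inv] at ha ⊢
      exact lt_of_le_of_ne ha fun h0 => h.ne i a (hx h0)
    · rintro ⟨i, a⟩ - ⟨j, b⟩ - hab
      simp only [Prod.mk.injEq] at hab ⊢
      obtain ⟨rfl, hab⟩ := hab
      exact ⟨rfl, by rw [← h.inv i a, hab, h.inv]⟩
    · rintro ⟨i, a⟩ ha
      simp only [Finset.mem_filter, Finset.mem_univ, true_and] at ha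
      exact ⟨(i, f i a), by simpa [h.inv] using ha.le, by simp [h.inv]⟩
  have h3 := Finset.card_filter_add_card_filter_not (s := (Finset.univ : Finset (Fin m × ι)))
    (fun ia => x ia.2 < x (f ia.1 ia.2))
  rw [h2, Finset.card_univ, Fintype.card_prod, Fintype.card_fin] at h3
  rw [h1]
  omega

lemma IsPacking.isPlaneDrawing (hp : InGeneralPosition p) (h : IsPacking p f) {t : ℝ}
    (ht : Function.Injective fun a => shear t (p a)) :
    IsPlaneDrawing (fun a => shear t (p a)) (fun a => p a 1)
      (rightEdges (fun a => shear t (p a)) f) where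
  inj := ht
  lt := by
    intro e he
    simp only [rightEdges, Finset.mem_image, Finset.mem_filter, Finset.mem_univ, true_and] at he
    obtain ⟨ia, hlt, rfl⟩ := he
    exact hlt
  noncross := by
    intro e he e' he' hne X h1 h2 h3 h4 h0
    simp only [rightEdges, Finset.mem_image, Finset.mem_filter, Finset.mem_univ, true_and]
      at he he'
    obtain ⟨⟨i, a⟩, hlt, rfl⟩ := he
    obtain ⟨⟨j, b⟩, hlt', rfl⟩ := he'
    obtain ⟨q, hq, q0, q1⟩ := exists_mem_openSegment h1 h2
    obtain ⟨q', hq', q0', q1'⟩ := exists_mem_openSegment h3 h4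
    have hqq : q = q' := shear_ext (q0.trans q0'.symm) (by rw [q1, q1', h0])
    refine h.noncross i j a b (fun hs => ?_) ⟨q, hq, hqq ▸ hq'⟩
    rcases Sym2.eq_iff.1 hs with ⟨k1, k2⟩ | ⟨k1, k2⟩
    · exact hne (Prod.ext k1 k2)
    · simp only at hlt hlt'
      rw [← k1, ← k2] at hlt'
      exact lt_asymm hlt hlt'
  novertex := by
    intro e he c h1 h2 h0
    simp only [rightEdges, Finset.mem_image, Finset.mem_filter, Finset.mem_univ, true_and] at he
    obtain ⟨⟨i, a⟩, hlt, rfl⟩ := he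
    obtain ⟨q, hq, q0, q1⟩ := exists_mem_openSegment h1 h2
    have hqc : q = p c := shear_ext q0 (by rw [q1, h0])
    subst hqc
    refine hp a (f i a) c (h.ne i a).symm ?_ ?_
      (det_eq_zero_of_mem_segment (openSegment_subset_segment _ _ _ hq))
    · rintro rfl; exact lt_irrefl _ h1
    · rintro rfl; exact lt_irrefl _ h2

/-- At most five pairwise non-crossing plane perfect matchings can be packed. -/
theorem IsPacking.le_five [Nonempty ι] (hinj : Function.Injective p) (hp : InGeneralPosition p)
    (h : IsPacking p f) : m ≤ 5 := by
  obtain ⟨t, ht⟩ := exists_shear_injective hinj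
  have h1 := (h.isPlaneDrawing hp ht).card_lt
  have h2 := h.card_rightEdges ht
  by_contra! hm
  -- Six matchings would already have `3 * n` edges.
  have h3 : 6 * Fintype.card ι ≤ m * Fintype.card ι := Nat.mul_le_mul_right _ hm
  omega

end UpperBound

theorem CanPack.le_five {P : Finset Plane} (hP : GeneralPosition P) (hne : P.Nonempty) {m : ℕ}
    (h : CanPack P m) : m ≤ 5 := by
  obtain ⟨f, hf⟩ := h.exists_isPacking (Equiv.refl P)
  have : Nonempty P := hne.to_subtype
  exact hf.le_five Subtype.val_injective ((generalPosition_iff (Equiv.refl P)).1 hP)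

/-! ### A star-shaped polygon and two matchings -/

lemma exists_equiv_strictMono {α : Type*} [Fintype α] {κ : α → ℝ} (hκ : Function.Injective κ)
    {n : ℕ} (hn : Fintype.card α = n) : ∃ e : Fin n ≃ α, StrictMono fun i => κ (e i) := by
  let := LinearOrder.lift' κ hκ
  exact ⟨(Fintype.orderIsoFinOfCardEq α hn).toEquiv,
    fun i j hij => (Fintype.orderIsoFinOfCardEq α hn).strictMono hij⟩

lemma det_eq_shear (t : ℝ) (a b c : Plane) : det a b c =
    (shear t b - shear t a) * (c 1 - a 1) - (b 1 - a 1) * (shear t c - shear t a) := by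
  unfold det shear; ring

/-- The points of `p` are listed in counterclockwise order around the extreme point `p 0`. -/
def IsRadial {k : ℕ} (p : Fin (k + 1) → Plane) : Prop :=
  ∀ i j, 0 < i → i < j → 0 < det (p 0) (p i) (p j)

/-- Every finite point set in general position has a counterclockwise enumeration around one of
its extreme points. -/
lemma exists_isRadial {P : Finset Plane} (hP : GeneralPosition P) {k : ℕ} (hk : P.card = k + 1) :
    ∃ e : Fin (k + 1) ≃ P, IsRadial fun i => (e i : Plane) := by
  classical
  obtain ⟨t, ht⟩ := exists_shear_injective (p := fun q : P => (q : Plane)) Subtype.val_injective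
  have hgp : InGeneralPosition fun q : P => (q : Plane) :=
    (generalPosition_iff (Equiv.refl P)).1 hP
  have hne : Nonempty P := (Finset.card_pos.1 (by omega)).to_subtype
  obtain ⟨o, ho⟩ := Finite.exists_min fun q : P => shear t q
  have hpos : ∀ q : P, q ≠ o → 0 < shear t q - shear t o := fun q hq =>
    sub_pos.2 (lt_of_le_of_ne (ho q) fun h => hq (ht h.symm))
  -- All other points lie strictly to the right of `o` after the shear, so their angular order
  -- around `o` is the order of the slopes `σ`.
  set σ : P → ℝ := fun q => ((q : Plane) 1 - (o : Plane) 1) / (shear t q - shear t o) with hσ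
  obtain ⟨B, hB⟩ := (Set.finite_range σ).bddBelow
  have hB : ∀ q, B ≤ σ q := fun q => hB ⟨q, rfl⟩
  have hdet : ∀ a b : P, a ≠ o → b ≠ o → det (o : Plane) a b
      = (σ b - σ a) * ((shear t a - shear t o) * (shear t b - shear t o)) := by
    intro a b ha hb
    have h1 := (hpos a ha).ne'
    have h2 := (hpos b hb).ne'
    rw [det_eq_shear t, hσ]
    field_simp
  -- The value `B - 1` lies below every slope, so sorting by `κ` puts `o` first.
  let κ : P → ℝ := fun q => if q = o then B - 1 else σ q
  have hκ : Function.Injective κ := by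
    intro a b hab
    simp only [κ] at hab
    split_ifs at hab with h1 h2 h2
    · rw [h1, h2]
    · linarith [hB b]
    · linarith [hB a]
    · by_contra hne
      refine hgp o a b (Ne.symm h1) (Ne.symm h2) hne ?_
      rw [hdet a b h1 h2, hab]; ring
  obtain ⟨e, he⟩ := exists_equiv_strictMono hκ (n := k + 1) (by simpa using hk)
  have h0 : e 0 = o := by
    by_contra h
    have h1 : (0 : Fin (k + 1)) ≤ e.symm o := Fin.zero_le _
    have h2 := he.monotone h1
    simp only [Equiv.apply_symm_apply, κ, if_neg h, if_true] at h2
    linarith [hB (e 0)]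
  refine ⟨e, fun i j hi hij => ?_⟩
  have hio : e i ≠ o := fun h => hi.ne' (e.injective (h.trans h0.symm))
  have hjo : e j ≠ o := fun h => (hi.trans hij).ne' (e.injective (h.trans h0.symm))
  have hlt := he hij
  simp only [κ, if_neg hio, if_neg hjo] at hlt
  simp only [h0]
  rw [hdet _ _ hio hjo]
  exact mul_pos (sub_pos.2 hlt) (mul_pos (hpos _ hio) (hpos _ hjo))

section StarPolygon

variable {k : ℕ} {p : Fin (k + 1) → Plane}

lemma IsRadial.det_neg (h : IsRadial p) {i j : Fin (k + 1)} (hj : 0 < j) (hji : j < i) :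
    det (p 0) (p i) (p j) < 0 := by
  rw [det_swap_right]
  exact neg_neg_of_pos (h j i hj hji)

lemma IsRadial.det_nonpos (h : IsRadial p) {i j : Fin (k + 1)} (hji : j ≤ i) :
    det (p 0) (p i) (p j) ≤ 0 := by
  rcases (Fin.zero_le j).eq_or_lt with rfl | hj
  · unfold det; apply le_of_eq; ring
  rcases hji.eq_or_lt with rfl | hji
  · unfold det; apply le_of_eq; ring
  · exact (h.det_neg hj hji).le

/-- The pairs of consecutive indices, in cyclic order. -/
def IsCyclicEdge (u v : Fin (k + 1)) : Prop :=
  (v : ℕ) = u + 1 ∨ ((u : ℕ) = 0 ∧ (v : ℕ) = k)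

/-- The ray from `p 0` through `p v` separates the two angular sectors that contain the edges. -/
lemma IsRadial.not_cross_of_lt (h : IsRadial p) {u v u' v' : Fin (k + 1)} (h1 : (v : ℕ) = u + 1)
    (h2 : (v' : ℕ) = u' + 1) (h3 : v < u') : ¬ Cross (p u) (p v) (p u') (p v') := by
  have hv : 0 < v := by rw [Fin.lt_def, Fin.val_zero]; omega
  have hu : u ≤ v := by rw [Fin.le_def]; omega
  have hv' : v < v' := by rw [Fin.lt_def] at *; omega
  exact fun hx => not_cross_of_det_nonneg_of_nonpos (p 0) (p v) (h v u' hv h3).le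
    (h v v' hv hv').le (h.det_nonpos hu) (h.det_nonpos le_rfl) (Or.inl (h v u' hv h3).ne') hx.symm

lemma IsRadial.not_cross_closing_edge (h : IsRadial p) {u v u' v' : Fin (k + 1)}
    (h1 : (u : ℕ) = 0) (h3 : 0 < u') (h4 : u' < v) (h5 : v' ≤ v) :
    ¬ Cross (p u) (p v) (p u') (p v') := by
  have hu : u = 0 := Fin.ext h1
  subst hu
  refine not_cross_of_det_nonneg_of_nonpos (p 0) (p v) (le_of_eq ?_) (le_of_eq ?_)
    (h.det_nonpos h4.le) (h.det_nonpos h5) (Or.inr (Or.inr (Or.inl (h.det_neg h3 h4).ne)))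
  all_goals unfold det; ring

lemma IsRadial.not_cross (h : IsRadial p) {u v u' v' : Fin (k + 1)} (h1 : IsCyclicEdge u v)
    (h2 : IsCyclicEdge u' v') (n1 : u ≠ u') (n2 : u ≠ v') (n3 : v ≠ u') (n4 : v ≠ v') :
    ¬ Cross (p u) (p v) (p u') (p v') := by
  simp only [ne_eq, Fin.ext_iff] at n1 n2 n3 n4
  rcases h1 with h1 | ⟨h1, h1'⟩ <;> rcases h2 with h2 | ⟨h2, h2'⟩
  · rcases lt_trichotomy (u : ℕ) u' with hc | hc | hc
    · exact h.not_cross_of_lt h1 h2 (by rw [Fin.lt_def]; omega)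
    · omega
    · exact fun hx => h.not_cross_of_lt h2 h1 (by rw [Fin.lt_def]; omega) hx.symm
  · refine fun hx => h.not_cross_closing_edge h2 ?_ ?_ ?_ hx.symm
    · rw [Fin.lt_def, Fin.val_zero]; omega
    · rw [Fin.lt_def]; omega
    · rw [Fin.le_def]; omega
  · refine h.not_cross_closing_edge h1 ?_ ?_ ?_
    · rw [Fin.lt_def, Fin.val_zero]; omega
    · rw [Fin.lt_def]; omega
    · rw [Fin.le_def]; omega
  · omega

/-- The two perfect matchings of an even cycle. -/
def cycleMatching (i : Fin 2) (a : Fin (k + 1)) : Fin (k + 1) :=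
  if (a : ℕ) % 2 = (i : ℕ) then
    if h : (a : ℕ) + 1 < k + 1 then ⟨(a : ℕ) + 1, h⟩ else 0
  else
    if (a : ℕ) = 0 then Fin.last k else ⟨(a : ℕ) - 1, by omega⟩

lemma cycleMatching_val (i : Fin 2) (a : Fin (k + 1)) :
    (cycleMatching i a : ℕ) = if (a : ℕ) % 2 = (i : ℕ) then
      (if (a : ℕ) < k then (a : ℕ) + 1 else 0)
      else (if (a : ℕ) = 0 then k else (a : ℕ) - 1 : ℕ) := by
  have := a.2
  unfold cycleMatching
  split_ifs <;> first | rfl | omega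

lemma isCyclicEdge_cycleMatching (i : Fin 2) (a : Fin (k + 1)) :
    IsCyclicEdge a (cycleMatching i a) ∨ IsCyclicEdge (cycleMatching i a) a := by
  have := cycleMatching_val i a
  have := a.2
  unfold IsCyclicEdge
  split_ifs at * <;> omega

/-- All edges used belong to one plane cycle, so only the combinatorics of alternate edges is left.
Odd `k` makes the parities match where the cycle closes; for `k = 1` the two matchings would
coincide. -/
lemma IsRadial.isPacking (h : IsRadial p) (hp : InGeneralPosition p) (hk : Odd k) (hk3 : 3 ≤ k) :
    IsPacking p (cycleMatching) := by
  have hk' := Nat.odd_iff.1 hk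
  refine hp.isPacking (fun i a => ?_) (fun i a h0 => ?_) (fun i j a hij h0 => ?_)
    (fun i j a b n1 n2 n3 n4 => ?_)
  · have h1 := cycleMatching_val i a
    have h2 := cycleMatching_val i (cycleMatching i a)
    have := a.2
    have := i.2
    rw [Fin.ext_iff]
    split_ifs at * <;> omega
  · have h1 := cycleMatching_val i a
    rw [h0] at h1
    split_ifs at * <;> omega
  · have h1 := cycleMatching_val i a
    have h2 := cycleMatching_val j a
    rw [h0] at h1
    rw [ne_eq, Fin.ext_iff] at hij
    have := a.2
    have := i.2
    have := j.2
    split_ifs at * <;> omega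
  · rcases isCyclicEdge_cycleMatching i a with h1 | h1 <;>
      rcases isCyclicEdge_cycleMatching j b with h2 | h2
    · exact h.not_cross h1 h2 n1 n2 n3 n4
    · rw [cross_swap_right]; exact h.not_cross h1 h2 n2 n1 n4 n3
    · rw [cross_swap_left]; exact h.not_cross h1 h2 n3 n4 n1 n2
    · rw [cross_swap_left, cross_swap_right]; exact h.not_cross h1 h2 n4 n3 n2 n1

end StarPolygon

theorem GeneralPosition.canPack_two {P : Finset Plane} (hP : GeneralPosition P)
    (heven : Even P.card) (h4 : 4 ≤ P.card) : CanPack P 2 := by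
  obtain ⟨k, hk⟩ : ∃ k, P.card = k + 1 := ⟨P.card - 1, by omega⟩
  obtain ⟨e, he⟩ := exists_isRadial hP hk
  have hgp := (generalPosition_iff e).1 hP
  have hodd : Odd k := by rw [Nat.odd_iff]; rw [Nat.even_iff] at heven; omega
  exact (he.isPacking hgp hodd (by omega)).canPack e hgp

/-! ### Convex position: at most two matchings -/

lemma ConvexPosition.eq_or_eq {P : Finset Plane} (hP : ConvexPosition P) {s : Set Plane}
    (hs : s ⊆ P) {a : Plane} (ha : a ∈ P) (h : a ∈ convexHull ℝ s) : a ∈ s := by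
  have := hP {q : P | (q : Plane) ∈ s} ⟨a, ha⟩ (by
    convert h
    ext q
    constructor
    · rintro ⟨q, hq, rfl⟩; exact hq
    · exact fun hq => ⟨⟨q, hs hq⟩, hq, rfl⟩)
  exact this

lemma ConvexPosition.generalPosition {P : Finset Plane} (hP : ConvexPosition P) :
    GeneralPosition P := by
  have key : ∀ a ∈ P, ∀ b ∈ P, ∀ c ∈ P, b ≠ a → b ≠ c → ¬ Wbtw ℝ a b c := by
    intro a ha b hb c hc h1 h2 h
    have h3 : b ∈ convexHull ℝ ({a, c} : Set Plane) := by
      rw [convexHull_pair]; exact h.mem_segment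
    rcases hP.eq_or_eq (by rintro q (rfl | rfl) <;> assumption) hb h3 with h4 | h4
    · exact h1 h4
    · exact h2 h4
  intro a ha b hb c hc h1 h2 h3 h
  rcases h.wbtw_or_wbtw_or_wbtw with h | h | h
  · exact key a ha b hb c hc h1.symm h3 h
  · exact key b hb c hc a ha h3.symm h2.symm h
  · exact key c hc a ha b hb h2 h1 h

/-- The three determinants, divided by `det a b c`, are the barycentric coordinates of `q`. -/
lemma mem_convexHull_triple {a b c q : Plane} (h1 : 0 ≤ det b c q) (h2 : 0 ≤ det c a q)
    (h3 : 0 ≤ det a b q) (h : 0 < det a b c) : q ∈ convexHull ℝ {a, b, c} := by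
  have hsum : det b c q + det c a q + det a b q = det a b c := by unfold det; ring
  have hq : q = ∑ i : Fin 3, ![det b c q / det a b c, det c a q / det a b c,
      det a b q / det a b c] i • ![a, b, c] i := by
    refine plane_ext ?_ ?_ <;> simp [Fin.sum_univ_three] <;> field_simp <;> unfold det <;> ring
  rw [hq]
  refine (convex_convexHull ℝ _).sum_mem ?_ ?_ ?_
  · intro i _; fin_cases i <;> simp <;> positivity
  · simp only [Fin.sum_univ_three, Matrix.cons_val]
    rw [← add_div, ← add_div, hsum, div_self h.ne']
  · intro i _
    refine subset_convexHull ℝ _ ?_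
    fin_cases i <;> simp

/-- All triples with increasing indices are oriented counterclockwise. -/
def IsCounterclockwise {n : ℕ} (p : Fin n → Plane) : Prop :=
  ∀ i j k, i < j → j < k → 0 < det (p i) (p j) (p k)

lemma ConvexPosition.isCounterclockwise {P : Finset Plane} (hP : ConvexPosition P) {k : ℕ}
    (e : Fin (k + 1) ≃ P) (he : IsRadial fun i => (e i : Plane)) :
    IsCounterclockwise fun i => (e i : Plane) := by
  intro i j l hij hjl
  rcases (Fin.zero_le i).eq_or_lt with rfl | hi
  · exact he j l hij hjl
  have hj := hi.trans hij
  have ne : ∀ {a b : Fin (k + 1)}, a ≠ b → (e a : Plane) ≠ e b := fun hab h =>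
    hab (e.injective (Subtype.ext h))
  by_contra! hcon
  -- A clockwise turn or no turn at `j` would put that point into the triangle spanned by the points
  -- `0`, `i` and `l`.
  have h1 : (e j : Plane) ∈ convexHull ℝ {(e 0 : Plane), (e i : Plane), (e l : Plane)} := by
    refine mem_convexHull_triple ?_ ?_ (he i j hi hij).le (he i l hi (hij.trans hjl))
    · rw [det_swap_right]; linarith
    · rw [← det_rotate]; exact (he j l hj hjl).le
  rcases hP.eq_or_eq (by rintro q (rfl | rfl | rfl) <;> exact Subtype.mem _) (e j).2 h1
    with h2 | h2 | h2
  · exact ne hj.ne' h2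
  · exact ne hij.ne' h2
  · exact ne hjl.ne h2

section Convex

variable {n : ℕ} {p : Fin n → Plane}

lemma IsCounterclockwise.cross (h : IsCounterclockwise p) {a b c d : Fin n} (h1 : a < b)
    (h2 : b < c) (h3 : c < d) : Cross (p a) (p c) (p b) (p d) := by
  have abc := h a b c h1 h2
  have abd := h a b d h1 (h2.trans h3)
  have acd := h a c d (h1.trans h2) h3
  have bcd := h b c d h2 h3
  refine cross_of_opposite_sides ?_ ?_
  · rw [det_swap_right (p a)]; nlinarith
  · rw [det_rotate, det_swap_right (p b)]; nlinarith

lemma IsCounterclockwise.exists_neighbor_consecutive (h : IsCounterclockwise p) {m : ℕ}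
    {f : Fin m → Fin n → Fin n} (hf : IsPacking p f) (hn : 0 < n) :
    ∃ b : Fin n, ∀ i, (f i b : ℕ) + 1 = b ∨ (f i b : ℕ) = b + 1 := by
  classical
  by_cases hex : ∃ ia : Fin m × Fin n, (ia.2 : ℕ) + 2 ≤ f ia.1 ia.2
  -- Take an edge `ac` of least span among those skipping a vertex, and let `b` be the successor of
  -- `a`. Edges at `b` cannot leave the range from `a` to `c` without crossing `ac`, and by
  -- minimality they cannot skip a vertex themselves.
  · obtain ⟨⟨i, a⟩, hia, hmin⟩ := Finset.exists_min_image
      (Finset.univ.filter fun ia : Fin m × Fin n => (ia.2 : ℕ) + 2 ≤ f ia.1 ia.2)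
      (fun ia => (f ia.1 ia.2 : ℕ) - ia.2)
      (by obtain ⟨ia, h⟩ := hex; exact ⟨ia, by simpa using h⟩)
    simp only [Finset.mem_filter, Finset.mem_univ, true_and] at hia hmin
    obtain ⟨c, hc⟩ : ∃ c, c = f i a := ⟨_, rfl⟩
    obtain ⟨b, hb⟩ : ∃ b : Fin n, (b : ℕ) = a + 1 := ⟨⟨a + 1, by omega⟩, rfl⟩
    rw [← hc] at hia hmin
    refine ⟨b, fun j => ?_⟩
    have hne : s(a, f i a) ≠ s(b, f j b) := by
      rw [← hc]
      intro h0
      rcases Sym2.eq_iff.1 h0 with ⟨h1, -⟩ | ⟨-, h1⟩ <;> rw [Fin.ext_iff] at h1 <;> omega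
    have hx := hf.noncross i j a b hne
    have hb' := hf.ne j b
    rw [ne_eq, Fin.ext_iff] at hb'
    have hmin' := hmin ⟨j, b⟩
    simp only at hmin'
    rw [← hc] at hx
    obtain ⟨d, hd⟩ : ∃ d, d = f j b := ⟨_, rfl⟩
    rw [← hd] at hx hb' hmin' ⊢
    have hab : a < b := by rw [Fin.lt_def]; omega
    have hbc : b < c := by rw [Fin.lt_def]; omega
    have h1 : a ≤ d := by
      by_contra! hlt
      exact hx (cross_swap_right.1 (h.cross hlt hab hbc).symm)
    have h2 : d ≤ c := by
      by_contra! hlt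
      exact hx (h.cross hab hbc hlt)
    rw [Fin.le_def] at h1 h2
    omega
  -- If no edge skips a vertex, the first vertex can only be joined to the second.
  · push Not at hex
    refine ⟨⟨0, hn⟩, fun i => ?_⟩
    have h1 := hex (i, ⟨0, hn⟩)
    have h2 := hf.ne i ⟨0, hn⟩
    rw [ne_eq, Fin.ext_iff] at h2
    simp only at h1 h2 ⊢
    omega

lemma IsCounterclockwise.le_two (h : IsCounterclockwise p) {m : ℕ}
    {f : Fin m → Fin n → Fin n} (hf : IsPacking p f) (hn : 0 < n) : m ≤ 2 := by
  obtain ⟨b, hb⟩ := h.exists_neighbor_consecutive hf hn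
  by_contra! hm
  have hd : ∀ i j : Fin m, i ≠ j → (f i b : ℕ) ≠ f j b := fun i j hij h0 =>
    hf.disj i j b hij (Fin.ext h0)
  have b0 := hb ⟨0, by omega⟩
  have b1 := hb ⟨1, by omega⟩
  have b2 := hb ⟨2, by omega⟩
  have d01 := hd ⟨0, by omega⟩ ⟨1, by omega⟩ (by simp)
  have d02 := hd ⟨0, by omega⟩ ⟨2, by omega⟩ (by simp)
  have d12 := hd ⟨1, by omega⟩ ⟨2, by omega⟩ (by simp)
  omega

end Convex

theorem ConvexPosition.isGreatest {P : Finset Plane} (hP : ConvexPosition P)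
    (heven : Even P.card) (h4 : 4 ≤ P.card) : IsGreatest {m : ℕ | CanPack P m} 2 := by
  refine ⟨hP.generalPosition.canPack_two heven h4, fun m hm => ?_⟩
  obtain ⟨k, hk⟩ : ∃ k, P.card = k + 1 := ⟨P.card - 1, by omega⟩
  obtain ⟨e, he⟩ := exists_isRadial hP.generalPosition hk
  obtain ⟨f, hf⟩ := CanPack.exists_isPacking e hm
  exact (hP.isCounterclockwise e he).le_two hf (by omega)

/-! ### Convex position for every number of points -/

/-- The point of the standard parabola with abscissa `i`. -/
noncomputable def parabola (n : ℕ) (i : Fin n) : Plane := !₂[(i : ℝ), (i : ℝ) ^ 2]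

lemma parabola_injective (n : ℕ) : Function.Injective (parabola n) := by
  intro i j h
  have := congrArg (fun q : Plane => q 0) h
  simp only [parabola, PiLp.toLp_apply, Matrix.cons_val_zero, Nat.cast_inj] at this
  exact Fin.ext this

lemma convexIndependent_parabola (n : ℕ) : ConvexIndependent ℝ (parabola n) := by
  rw [convexIndependent_iff_notMem_convexHull_sdiff]
  intro i s hi
  -- This is the open half-plane above the tangent at the point `i`; it contains all other points of
  -- the parabola.
  have hconv : Convex ℝ {q : Plane | 0 < q 1 - 2 * i * q 0 + i ^ 2} := by
    rintro a ha b hb u v hu hv huv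
    simp only [Set.mem_ofPred_eq, PiLp.add_apply, PiLp.smul_apply, smul_eq_mul] at *
    obtain rfl : u = 1 - v := by linarith
    rcases hv.eq_or_lt with rfl | hv
    · linarith
    · nlinarith [mul_pos hv hb, mul_nonneg hu ha.le]
  have hsub : parabola n '' (s \ {i}) ⊆ {q : Plane | 0 < q 1 - 2 * i * q 0 + i ^ 2} := by
    rintro _ ⟨j, ⟨-, hj⟩, rfl⟩
    have hne : ((j : ℕ) : ℝ) - (i : ℕ) ≠ 0 := by
      rw [sub_ne_zero]
      exact fun h => hj (Fin.ext (by exact_mod_cast h))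
    have := pow_pos (abs_pos.2 hne) 2
    rw [sq_abs] at this
    simp only [parabola, Set.mem_ofPred_eq, Matrix.cons_val_zero,
      Matrix.cons_val_one]
    nlinarith
  have := convexHull_min hsub hconv hi
  simp only [parabola, Set.mem_ofPred_eq, Matrix.cons_val_zero,
    Matrix.cons_val_one] at this
  nlinarith

/-- The finite point set enumerated by an injective family. -/
lemma exists_finset_equiv {ι : Type*} [Fintype ι] {p : ι → Plane} (hp : Function.Injective p) :
    ∃ (P : Finset Plane) (e : ι ≃ P), P.card = Fintype.card ι ∧ ∀ a, (e a : Plane) = p a := by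
  refine ⟨Finset.univ.map ⟨p, hp⟩, Equiv.ofBijective
    (fun a => ⟨p a, Finset.mem_map_of_mem ⟨p, hp⟩ (Finset.mem_univ a)⟩) ⟨?_, ?_⟩, ?_, ?_⟩
  · intro a b h
    exact hp (Subtype.ext_iff.1 h)
  · rintro ⟨q, hq⟩
    obtain ⟨a, -, rfl⟩ := Finset.mem_map.1 hq
    exact ⟨a, rfl⟩
  · simp
  · intro a; rfl

lemma exists_convexPosition (n : ℕ) : ∃ P : Finset Plane, P.card = n ∧ ConvexPosition P := by
  obtain ⟨P, e, hcard, he⟩ := exists_finset_equiv (parabola_injective n)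
  refine ⟨P, by simpa using hcard, ?_⟩
  have h := (convexIndependent_parabola n).comp_embedding e.symm.toEmbedding
  have heq : (fun q : P => (q : Plane)) = parabola n ∘ e.symm := by
    funext q
    simp [← he]
  unfold ConvexPosition
  rwa [heq]

/-! ### Five matchings on twelve points -/

/-- Integer coordinates of the vertices in a straight-line drawing of the icosahedron. -/
def icosahedronCoord : Fin 12 → ℤ × ℤ :=
  ![(15, 0), (-8, 12), (-7, -14), (4, -1), (3, 4), (-3, 4), (-5, 1), (-3, -4), (3, -4), (2, 2),
    (-2, 0), (1, -2)]

/-- A decomposition of the icosahedron graph into five perfect matchings. -/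
def icosahedronMatching : Fin 5 → Fin 12 → Fin 12 :=
  ![![1, 0, 6, 4, 3, 9, 2, 8, 7, 5, 11, 10],
    ![2, 4, 0, 8, 1, 6, 5, 10, 3, 11, 7, 9],
    ![3, 2, 1, 0, 5, 4, 7, 6, 11, 10, 9, 8],
    ![4, 5, 8, 9, 0, 1, 10, 11, 2, 3, 6, 7],
    ![8, 6, 7, 11, 9, 10, 1, 2, 0, 4, 5, 3]]

/-- The vertices of the icosahedron in its straight-line drawing. -/
noncomputable def icosahedron (a : Fin 12) : Plane :=
  !₂[((icosahedronCoord a).1 : ℝ), ((icosahedronCoord a).2 : ℝ)]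

/-- Twice the signed area of a lattice triangle. -/
def intDet (a b c : ℤ × ℤ) : ℤ := (b.1 - a.1) * (c.2 - a.2) - (b.2 - a.2) * (c.1 - a.1)

lemma det_icosahedron (a b c : Fin 12) : det (icosahedron a) (icosahedron b) (icosahedron c) =
    (intDet (icosahedronCoord a) (icosahedronCoord b) (icosahedronCoord c) : ℝ) := by
  simp [det, intDet, icosahedron]

lemma inGeneralPosition_icosahedron : InGeneralPosition icosahedron := by
  have key : ∀ a b c : Fin 12, a ≠ b → a ≠ c → b ≠ c →
      intDet (icosahedronCoord a) (icosahedronCoord b) (icosahedronCoord c) ≠ 0 := by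
    decide +kernel
  intro a b c h1 h2 h3
  rw [det_icosahedron]
  exact_mod_cast key a b c h1 h2 h3

lemma icosahedron_injective : Function.Injective icosahedron := by
  have key : ∀ a b : Fin 12, icosahedronCoord a = icosahedronCoord b → a = b := by
    decide +kernel
  intro a b h
  refine key a b (Prod.ext ?_ ?_)
  · simpa [icosahedron] using congrArg (fun q : Plane => q 0) h
  · simpa [icosahedron] using congrArg (fun q : Plane => q 1) h

lemma isPacking_icosahedron : IsPacking icosahedron icosahedronMatching := by
  -- The certificate of non-crossing: one of the two edges lies strictly on one side of the line
  -- through the other.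
  have key : ∀ i j a b, a ≠ b → a ≠ icosahedronMatching j b → icosahedronMatching i a ≠ b →
      icosahedronMatching i a ≠ icosahedronMatching j b →
      0 < intDet (icosahedronCoord a) (icosahedronCoord (icosahedronMatching i a))
            (icosahedronCoord b) *
          intDet (icosahedronCoord a) (icosahedronCoord (icosahedronMatching i a))
            (icosahedronCoord (icosahedronMatching j b)) ∨
      0 < intDet (icosahedronCoord b) (icosahedronCoord (icosahedronMatching j b))
            (icosahedronCoord a) *
          intDet (icosahedronCoord b) (icosahedronCoord (icosahedronMatching j b))
            (icosahedronCoord (icosahedronMatching i a)) := by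
    decide +kernel
  refine inGeneralPosition_icosahedron.isPacking (by decide +kernel) (by decide +kernel)
    (by decide +kernel) (fun i j a b n1 n2 n3 n4 => ?_)
  rcases key i j a b n1 n2 n3 n4 with h | h
  · refine not_cross_of_same_side ?_
    rw [det_icosahedron, det_icosahedron]
    exact_mod_cast h
  · refine fun hx => not_cross_of_same_side ?_ hx.symm
    rw [det_icosahedron, det_icosahedron]
    exact_mod_cast h

/-! ### Arbitrarily large examples from translated copies -/

open Filter

lemma eventually_quadratic_ne_zero {A B C : ℝ} (h : A ≠ 0 ∨ B ≠ 0) :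
    ∀ᶠ t : ℝ in atTop, A * t ^ 2 + B * t + C ≠ 0 := by
  have hne : Polynomial.C A * Polynomial.X ^ 2 + Polynomial.C B * Polynomial.X
      + Polynomial.C C ≠ 0 := by
    intro h0
    have h1 := congrArg (fun P => Polynomial.coeff P 1) h0
    have h2 := congrArg (fun P => Polynomial.coeff P 2) h0
    simp [Polynomial.coeff_C] at h1 h2
    rcases h with h | h <;> contradiction
  filter_upwards [Polynomial.eventually_atTop_not_isRoot _ hne] with t ht
  simpa [Polynomial.IsRoot] using ht

/-- The point `(t, t ^ 2)`. -/
noncomputable def curve (t : ℝ) : Plane := !₂[t, t ^ 2]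

/-- As a function of `t` the determinant is a polynomial whose coefficients at `t ^ 2` and `t` are,
up to sign, the coordinates of `b - a`. Translating along a parabola rather than a line rules out
that the motion stays parallel to `ab`. -/
lemma eventually_det_ne_zero {a b c : Plane} (h : a ≠ b) :
    ∀ᶠ t : ℝ in atTop, det a b (c + curve t) ≠ 0 := by
  have h' : b 0 - a 0 ≠ 0 ∨ -(b 1 - a 1) ≠ 0 := by
    by_contra! hcon
    exact h (plane_ext (by linarith [hcon.1]) (by linarith [hcon.2]))
  filter_upwards [eventually_quadratic_ne_zero
    (C := (b 0 - a 0) * (c 1 - a 1) - (b 1 - a 1) * (c 0 - a 0)) h'] with t ht h0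
  refine ht ?_
  rw [← h0]
  simp [det, curve]
  ring

lemma eventually_det_add_ne_zero {a b c : Plane} (h : b ≠ c) :
    ∀ᶠ t : ℝ in atTop, det a (b + curve t) (c + curve t) ≠ 0 := by
  have h' : -(c 0 - b 0) ≠ 0 ∨ c 1 - b 1 ≠ 0 := by
    by_contra! hcon
    exact h (plane_ext (by linarith [hcon.1]) (by linarith [hcon.2]))
  filter_upwards [eventually_quadratic_ne_zero
    (C := (c 0 - b 0) * (a 1 - b 1) - (c 1 - b 1) * (a 0 - b 0)) h'] with t ht h0
  refine ht ?_
  rw [← h0]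
  simp [det, curve]
  ring

lemma det_add (a b c v : Plane) : det (a + v) (b + v) (c + v) = det a b c := by
  simp [det]

lemma cross_add {a b c d : Plane} (v : Plane) (h : Cross (a + v) (b + v) (c + v) (d + v)) :
    Cross a b c d := by
  obtain ⟨q, ⟨s, t, hs, ht, hst, rfl⟩, ⟨s', t', hs', ht', hst', h⟩⟩ := h
  refine ⟨s • a + t • b, ⟨s, t, hs, ht, hst, rfl⟩, ⟨s', t', hs', ht', hst', ?_⟩⟩
  have e1 : s • (a + v) + t • (b + v) = (s • a + t • b) + v := by
    rw [smul_add, smul_add, add_add_add_comm, ← add_smul, hst, one_smul]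
  have e2 : s' • (c + v) + t' • (d + v) = (s' • c + t' • d) + v := by
    rw [smul_add, smul_add, add_add_add_comm, ← add_smul, hst', one_smul]
  rw [e1, e2] at h
  exact add_right_cancel h

lemma not_cross_of_vertical_line {a b c d : Plane} (h1 : a 0 < c 0) (h2 : a 0 < d 0)
    (h3 : b 0 < c 0) (h4 : b 0 < d 0) : ¬ Cross a b c d := by
  have hdet : ∀ q : Plane, det !₂[max (a 0) (b 0), 0] !₂[max (a 0) (b 0), 1] q
      = max (a 0) (b 0) - q 0 := by intro q; simp [det]
  have hc := max_lt h1 h3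
  have hd := max_lt h2 h4
  refine not_cross_of_det_nonneg_of_nonpos !₂[max (a 0) (b 0), 0] !₂[max (a 0) (b 0), 1]
    ?_ ?_ ?_ ?_ (Or.inr (Or.inr (Or.inl ?_)))
  all_goals rw [hdet]
  · linarith [le_max_left (a 0) (b 0)]
  · linarith [le_max_right (a 0) (b 0)]
  · linarith
  · linarith
  · linarith

section Union

variable {ι κ : Type*} {p : ι → Plane} {q : κ → Plane}

/-- Each mixed triple is non-collinear for all large `t`, and for large `t` the second set lies
entirely to the right of the first. Finitely many such conditions hold simultaneously. -/
lemma exists_translate [Finite ι] [Finite κ] (hp : Function.Injective p)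
    (hq : Function.Injective q) (gp : InGeneralPosition p) (gq : InGeneralPosition q) :
    ∃ v : Plane, InGeneralPosition (Sum.elim p fun b => q b + v) ∧
      ∀ a b, p a 0 < (q b + v) 0 := by
  have e1 : ∀ᶠ t in atTop, ∀ a b, p a 0 < (q b + curve t) 0 := by
    refine eventually_all.2 fun a => eventually_all.2 fun b => ?_
    filter_upwards [eventually_gt_atTop (p a 0 - q b 0)] with t ht
    simp [curve]
    linarith
  have e2 : ∀ᶠ t in atTop, ∀ a b c, a ≠ b → det (p a) (p b) (q c + curve t) ≠ 0 := by
    refine eventually_all.2 fun a => eventually_all.2 fun b => eventually_all.2 fun c => ?_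
    by_cases h : a = b
    · exact Eventually.of_forall fun t h' => absurd h h'
    · filter_upwards [eventually_det_ne_zero (c := q c) (hp.ne h)] with t ht _ using ht
  have e3 : ∀ᶠ t in atTop, ∀ a b c, b ≠ c →
      det (p a) (q b + curve t) (q c + curve t) ≠ 0 := by
    refine eventually_all.2 fun a => eventually_all.2 fun b => eventually_all.2 fun c => ?_
    by_cases h : b = c
    · exact Eventually.of_forall fun t h' => absurd h h'
    · filter_upwards [eventually_det_add_ne_zero (a := p a) (hq.ne h)] with t ht _ using ht
  obtain ⟨t, h1, h2, h3⟩ := (e1.and (e2.and e3)).exists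
  refine ⟨curve t, ?_, h1⟩
  rintro (a | a) (b | b) (c | c) n1 n2 n3 <;>
    simp only [ne_eq, Sum.inl.injEq, Sum.inr.injEq] at n1 n2 n3 <;>
    simp only [Sum.elim_inl, Sum.elim_inr]
  · exact gp a b c n1 n2 n3
  · exact h2 a b c n1
  · rw [det_swap_right, neg_ne_zero]; exact h2 a c b n2
  · exact h3 a b c n3
  · rw [← det_rotate]; exact h2 b c a n3
  · rw [← det_rotate, det_swap_right, neg_ne_zero]; exact h3 b a c n2
  · rw [det_rotate (p c)]; exact h3 c a b n1
  · rw [det_add]; exact gq a b c n1 n2 n3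

lemma IsPacking.sum {m : ℕ} {f : Fin m → ι → ι} {g : Fin m → κ → κ} (hf : IsPacking p f)
    (hg : IsPacking q g) {v : Plane} (hgp : InGeneralPosition (Sum.elim p fun b => q b + v))
    (hv : ∀ a b, p a 0 < (q b + v) 0) :
    IsPacking (Sum.elim p fun b => q b + v) fun i => Sum.map (f i) (g i) := by
  refine hgp.isPacking ?_ ?_ ?_ ?_
  · rintro i (a | a) <;> simp [hf.inv, hg.inv]
  · rintro i (a | a) <;> simp [hf.ne, hg.ne]
  · rintro i j (a | a) hij
    · simpa using hf.disj i j a hij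
    · simpa using hg.disj i j a hij
  · rintro i j (a | a) (b | b) n1 n2 n3 n4 <;>
      simp only [Sum.map_inl, Sum.map_inr, ne_eq, Sum.inl.injEq, Sum.inr.injEq] at n1 n2 n3 n4 <;>
      simp only [Sum.map_inl, Sum.map_inr, Sum.elim_inl, Sum.elim_inr]
    · refine hf.noncross i j a b fun h => ?_
      rcases Sym2.eq_iff.1 h with ⟨h, -⟩ | ⟨h, -⟩ <;> contradiction
    · exact not_cross_of_vertical_line (hv _ _) (hv _ _) (hv _ _) (hv _ _)
    · exact fun hx => not_cross_of_vertical_line (hv _ _) (hv _ _) (hv _ _) (hv _ _) hx.symm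
    · refine fun hx => hg.noncross i j a b (fun h => ?_) (cross_add v hx)
      rcases Sym2.eq_iff.1 h with ⟨h, -⟩ | ⟨h, -⟩ <;> contradiction

lemma injective_sum_elim_translate (hp : Function.Injective p) (hq : Function.Injective q)
    {v : Plane} (hv : ∀ a b, p a 0 < (q b + v) 0) :
    Function.Injective (Sum.elim p fun b => q b + v) :=
  hp.sumElim (fun _ _ h => hq (add_right_cancel h)) fun a b h =>
    (hv a b).ne (congrArg (fun z : Plane => z 0) h)

end Union

lemma exists_isPacking_five (k : ℕ) : ∃ (ι : Type) (_ : Fintype ι) (p : ι → Plane)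
    (f : Fin 5 → ι → ι), Fintype.card ι = 12 * (k + 1) ∧ Function.Injective p ∧
      InGeneralPosition p ∧ IsPacking p f := by
  induction k with
  | zero =>
    exact ⟨Fin 12, inferInstance, icosahedron, icosahedronMatching, by simp,
      icosahedron_injective, inGeneralPosition_icosahedron, isPacking_icosahedron⟩
  | succ k ih =>
    obtain ⟨ι, _, p, f, hcard, hinj, hgp, hf⟩ := ih
    obtain ⟨v, h1, h2⟩ := exists_translate hinj icosahedron_injective hgp
      inGeneralPosition_icosahedron
    refine ⟨ι ⊕ Fin 12, inferInstance, _, _, ?_,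
      injective_sum_elim_translate hinj icosahedron_injective h2, h1,
      hf.sum isPacking_icosahedron h1 h2⟩
    rw [Fintype.card_sum, hcard, Fintype.card_fin]
    ring

lemma exists_isGreatest_five (k : ℕ) : ∃ P : Finset Plane, P.card = 12 * (k + 1) ∧
    GeneralPosition P ∧ IsGreatest {m : ℕ | CanPack P m} 5 := by
  obtain ⟨ι, _, p, f, hcard, hinj, hgp, hf⟩ := exists_isPacking_five k
  obtain ⟨P, e, hP, he⟩ := exists_finset_equiv hinj
  obtain rfl : (fun a => (e a : Plane)) = p := funext he
  have hP' := (generalPosition_iff e).2 hgp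
  refine ⟨P, hP.trans hcard, hP', hf.canPack e hgp, fun m hm => ?_⟩
  exact CanPack.le_five hP' (Finset.card_pos.1 (by omega)) hm

end PlaneMatching

theorem mainTheorem7 :
    -- lower and upper bound for every point set in general position
    (∀ P : Finset PlaneMatching.Plane, PlaneMatching.GeneralPosition P →
      Even P.card → 4 ≤ P.card →
        PlaneMatching.CanPack P 2 ∧ ∀ m : ℕ, PlaneMatching.CanPack P m → m ≤ 5) ∧
    -- point sets in convex position attain the lower bound
    (∀ P : Finset PlaneMatching.Plane, PlaneMatching.ConvexPosition P →
      Even P.card → 4 ≤ P.card →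
        IsGreatest {m : ℕ | PlaneMatching.CanPack P m} 2) ∧
    -- the lower bound is tight for every admissible number of points
    (∀ n : ℕ, Even n → 4 ≤ n →
      ∃ P : Finset PlaneMatching.Plane, P.card = n ∧ PlaneMatching.GeneralPosition P ∧
        PlaneMatching.ConvexPosition P ∧
        IsGreatest {m : ℕ | PlaneMatching.CanPack P m} 2) ∧
    -- the upper bound is attained by twelve points
    (∃ P : Finset PlaneMatching.Plane, P.card = 12 ∧ PlaneMatching.GeneralPosition P ∧
        IsGreatest {m : ℕ | PlaneMatching.CanPack P m} 5) ∧
    -- the upper bound is attained by arbitrarily large point sets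
    (∀ N : ℕ, ∃ P : Finset PlaneMatching.Plane, N ≤ P.card ∧ Even P.card ∧
        PlaneMatching.GeneralPosition P ∧
        IsGreatest {m : ℕ | PlaneMatching.CanPack P m} 5) := by
  refine ⟨fun P hP heven h4 => ⟨hP.canPack_two heven h4, fun m hm =>
    hm.le_five hP (Finset.card_pos.1 (by omega))⟩, fun P hP heven h4 => hP.isGreatest heven h4,
    fun n heven h4 => ?_, PlaneMatching.exists_isGreatest_five 0, fun N => ?_⟩
  · obtain ⟨P, rfl, hP⟩ := PlaneMatching.exists_convexPosition n
    exact ⟨P, rfl, hP.generalPosition, hP, hP.isGreatest heven h4⟩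
  -- The set has `12 * (N + 1)` points, an even number that is at least `N`.
  · obtain ⟨P, hcard, hP, hmax⟩ := PlaneMatching.exists_isGreatest_five N
    refine ⟨P, by omega, ?_, hP, hmax⟩
    rw [hcard, Nat.even_iff]
    omega
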